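/- Let $H_1$, $H_2$ be complex Hilbert spaces and let $S,T\colon B(H_1)\to B(H_2)$ be completely positive linear maps. Write $S\le T$ if $T-S$ is completely positive. Let $E$ be a complex Hilbert space and $V\colon H_2\to H_1\otimes E$ (Hilbert space tensor product) a bounded operator such that $$T(A)=V^*(A\otimes 1_E)V\qquad\text{for all }A\in B(H_1)$$ is a canonical Stinespring dilation of $T$, that is, this identity holds and the linear span of $\{(A\otimes 1_E)V\psi : A\in B(H_1),\ \psi\in H_2\}$ is dense in $H_1\otimes E$. Then $S\le T$ if and only if there exists a positive operator $F\in B(E)$ with $\|F\|\le 1$ such that $$S(A)=V^*(A\otimes F)V\qquad\text{for all }A\in B(H_1).$$ -/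

import Mathlib

open scoped TensorProduct InnerProductSpace CStarAlgebra

noncomputable section

/-- The Hilbert space tensor product: the completion of the algebraic tensor product for the
inner product `⟪x ⊗ₜ y, x' ⊗ₜ y'⟫ = ⟪x, x'⟫ * ⟪y, y'⟫`. -/
abbrev HilbertTensor (H E : Type*) [NormedAddCommGroup H] [InnerProductSpace ℂ H]
    [NormedAddCommGroup E] [InnerProductSpace ℂ E] : Type _ :=
  UniformSpace.Completion (H ⊗[ℂ] E)

/-- The elementary tensor `x ⊗ y` as a vector of the Hilbert space tensor product. -/
def hilbertTmul {H E : Type*} [NormedAddCommGroup H] [InnerProductSpace ℂ H]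
    [NormedAddCommGroup E] [InnerProductSpace ℂ E] (x : H) (y : E) : HilbertTensor H E :=
  ((x ⊗ₜ[ℂ] y : H ⊗[ℂ] E) : UniformSpace.Completion (H ⊗[ℂ] E))

/-- The tensor product `A ⊗ F` of bounded operators: the continuous extension of the algebraic
tensor product of `A` and `F` to the Hilbert space tensor product. -/
def tensorOp {H E : Type*} [NormedAddCommGroup H] [InnerProductSpace ℂ H]
    [NormedAddCommGroup E] [InnerProductSpace ℂ E] (A : H →L[ℂ] H) (F : E →L[ℂ] E) :
    HilbertTensor H E →L[ℂ] HilbertTensor H E :=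
  (TensorProduct.mapL A F).completion

theorem tensorOp_hilbertTmul {H E : Type*} [NormedAddCommGroup H] [InnerProductSpace ℂ H]
    [NormedAddCommGroup E] [InnerProductSpace ℂ E] (A : H →L[ℂ] H) (F : E →L[ℂ] E)
    (x : H) (y : E) : tensorOp A F (hilbertTmul x y) = hilbertTmul (A x) (F y) := by
  simp [tensorOp, hilbertTmul]

theorem inner_hilbertTmul {H E : Type*} [NormedAddCommGroup H] [InnerProductSpace ℂ H]
    [NormedAddCommGroup E] [InnerProductSpace ℂ E] (x x' : H) (y y' : E) :
    ⟪hilbertTmul x y, hilbertTmul x' y'⟫_ℂ = ⟪x, x'⟫_ℂ * ⟪y, y'⟫_ℂ := by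
  simp [hilbertTmul]

/-- The partial order of CP maps: `S` is completely dominated by `T`, i.e. `T - S` is again
completely positive. -/
def CompletelyDominated {A B : Type*} [NonUnitalCStarAlgebra A] [NonUnitalCStarAlgebra B]
    [PartialOrder A] [PartialOrder B] [StarOrderedRing A] [StarOrderedRing B]
    (S T : A →CP B) : Prop :=
  ∃ R : A →CP B, R.toLinearMap = T.toLinearMap - S.toLinearMap

/-- `V : H₂ → H₁ ⊗ E` gives the canonical Stinespring dilation `T(A) = V* (A ⊗ 1) V` of
`T : B(H₁) → B(H₂)`: the dilation formula holds, and the dilation is minimal, i.e. the vectors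
`(A ⊗ 1) V ψ` form a total set in `H₁ ⊗ E`. -/
structure IsCanonicalStinespring {H₁ H₂ E : Type*}
    [NormedAddCommGroup H₁] [InnerProductSpace ℂ H₁] [CompleteSpace H₁]
    [NormedAddCommGroup H₂] [InnerProductSpace ℂ H₂] [CompleteSpace H₂]
    [NormedAddCommGroup E] [InnerProductSpace ℂ E] [CompleteSpace E]
    (T : (H₁ →L[ℂ] H₁) →CP (H₂ →L[ℂ] H₂)) (V : H₂ →L[ℂ] HilbertTensor H₁ E) : Prop where
  dilation : ∀ A : H₁ →L[ℂ] H₁,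
    T A = ContinuousLinearMap.adjoint V ∘L tensorOp A (1 : E →L[ℂ] E) ∘L V
  minimal : (Submodule.span ℂ
    {x | ∃ (A : H₁ →L[ℂ] H₁) (ψ : H₂), x = tensorOp A (1 : E →L[ℂ] E) (V ψ)}).topologicalClosure
      = ⊤

end

/-!
If `S A = V⋆ (A ⊗ F) V` with `0 ≤ F ≤ 1`, write `1 - F = K⋆ K`; then `T - S` is
`A ↦ W⋆ (A ⊗ 1) W` with `W = (1 ⊗ K) V`. Such a map is completely positive: the amplification
`A ↦ A ⊗ 1` is a star homomorphism, and positivity of a matrix over `B(H)` can be tested on its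
quadratic form on column vectors (`CStarMatrix.nonneg_of_re_sum_inner_nonneg`), a test that is stable
under compression by `W`.

Conversely, complete positivity of `S` and of `T - S` says that the sesquilinear form
`∑ ⟪ψ_A, S(A⋆ B) φ_B⟫` on finitely supported families `(ψ_A)` of vectors of `H₂` lies between `0` and
`‖∑ (A ⊗ 1) V ψ_A‖²`. By minimality of the dilation the vectors `∑ (A ⊗ 1) V ψ_A` are dense, so the
form is given by an operator `0 ≤ G ≤ 1` on `H₁ ⊗ E` (`exists_isPositive_inner_eq`). As the form only
depends on `A⋆ B`, the operator `G` commutes with all `A ⊗ 1`, and the commutant of `B(H₁) ⊗ 1` is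
`1 ⊗ B(E)` (`exists_eq_tensorOp_one_of_commute`), so `G = 1 ⊗ F`.
-/

open ContinuousLinearMap

/-! ### Positivity of matrices of bounded operators -/

/-- A form of `CStarAlgebra.nonneg_iff_eq_star_mul_self` with the functional calculus instances taken
from the C⋆-algebra structure of `A`; they are not inferred directly for `A = CStarMatrix n n _`. -/
theorem CStarAlgebra.nonneg_iff_exists_eq_star_mul_self {A : Type*} [NonUnitalCStarAlgebra A]
    [PartialOrder A] [StarOrderedRing A] {a : A} : 0 ≤ a ↔ ∃ b, a = star b * b :=
  CStarAlgebra.nonneg_iff_eq_star_mul_self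

/-- A selfadjoint `a` that is not nonnegative takes a nonzero value `-r⋆ r` under the conjugation by
its negative part `d`: writing `d = q⋆ q` and `r = q d`, one has `d a d = -d³ = -r⋆ r`. -/
theorem IsSelfAdjoint.exists_star_mul_mul_eq_neg {A : Type*} [NonUnitalCStarAlgebra A]
    [PartialOrder A] [StarOrderedRing A] {a : A} (ha : IsSelfAdjoint a) :
    ∃ d r : A, star d * a * d = -(star r * r) ∧ (r = 0 → 0 ≤ a) := by
  have hds : star a⁻ = a⁻ := (IsSelfAdjoint.of_nonneg (CFC.negPart_nonneg a)).star_eq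
  obtain ⟨q, hq⟩ := CStarAlgebra.nonneg_iff_eq_star_mul_self.mp (CFC.negPart_nonneg a)
  refine ⟨a⁻, q * a⁻, ?_, fun h0 => ?_⟩
  · have had : a * a⁻ = -(a⁻ * a⁻) := by
      nth_rw 1 [← CFC.posPart_sub_negPart a ha]
      rw [sub_mul, CFC.posPart_mul_negPart, zero_sub]
    rw [mul_assoc, had, mul_neg, star_mul, mul_assoc, ← mul_assoc (star q), ← hq]
  · have hd : a⁻ = 0 := by
      rw [← CStarRing.star_mul_self_eq_zero_iff, hds]
      nth_rw 1 [hq]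
      rw [mul_assoc, h0, mul_zero]
    rw [← CFC.posPart_sub_negPart a ha, hd, sub_zero]
    exact CFC.posPart_nonneg a

section CStarMatrix

variable {n H : Type*} [Fintype n] [NormedAddCommGroup H] [InnerProductSpace ℂ H]

/-- The action of a matrix of bounded operators on `H` on column vectors with entries in `H`. -/
noncomputable def CStarMatrix.opMulVec (M : CStarMatrix n n (H →L[ℂ] H)) (x : n → H) (i : n) : H :=
  ∑ j, M i j (x j)

theorem CStarMatrix.opMulVec_mul (M N : CStarMatrix n n (H →L[ℂ] H)) (x : n → H) :
    (M * N).opMulVec x = M.opMulVec (N.opMulVec x) := by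
  ext i
  simp only [opMulVec, CStarMatrix.mul_apply, _root_.sum_apply, mul_apply, map_sum]
  exact Finset.sum_comm

theorem CStarMatrix.eq_zero_of_opMulVec_eq_zero {M : CStarMatrix n n (H →L[ℂ] H)}
    (h : ∀ x, M.opMulVec x = 0) : M = 0 := by
  classical
  ext i j v
  have := congrFun (h (Pi.single j v)) i
  simp only [opMulVec] at this
  rw [Finset.sum_eq_single j (fun b _ hb => by simp [hb]) (by simp)] at this
  simpa using this

variable [CompleteSpace H]

theorem CStarMatrix.sum_inner_opMulVec_star (M : CStarMatrix n n (H →L[ℂ] H)) (x y : n → H) :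
    ∑ i, ⟪x i, (star M).opMulVec y i⟫_ℂ = ∑ i, ⟪M.opMulVec x i, y i⟫_ℂ := by
  simp only [opMulVec, inner_sum, sum_inner, CStarMatrix.star_apply, star_eq_adjoint,
    adjoint_inner_right]
  exact Finset.sum_comm

theorem CStarMatrix.sum_inner_opMulVec_star_mul_self (M : CStarMatrix n n (H →L[ℂ] H))
    (x : n → H) :
    ∑ i, ⟪x i, (star M * M).opMulVec x i⟫_ℂ = ((∑ i, ‖M.opMulVec x i‖ ^ 2 : ℝ) : ℂ) := by
  rw [opMulVec_mul, sum_inner_opMulVec_star]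
  simp [inner_self_eq_norm_sq_to_K]

theorem CStarMatrix.re_sum_inner_nonneg {M : CStarMatrix n n (H →L[ℂ] H)} (hM : 0 ≤ M)
    (x : n → H) : 0 ≤ (∑ i, ⟪x i, M.opMulVec x i⟫_ℂ).re := by
  classical
  obtain ⟨N, rfl⟩ := CStarAlgebra.nonneg_iff_exists_eq_star_mul_self.mp hM
  rw [sum_inner_opMulVec_star_mul_self, Complex.ofReal_re]
  positivity

/-- A selfadjoint matrix of bounded operators is nonnegative in the C⋆-algebra of matrices as soon as
its quadratic form is: if `d⋆ M d = -r⋆ r`, the quadratic form of `M` at `d x` is `-‖r x‖²`, which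
forces `r = 0`. -/
theorem CStarMatrix.nonneg_of_re_sum_inner_nonneg {M : CStarMatrix n n (H →L[ℂ] H)}
    (hM : IsSelfAdjoint M) (h : ∀ x : n → H, 0 ≤ (∑ i, ⟪x i, M.opMulVec x i⟫_ℂ).re) : 0 ≤ M := by
  obtain ⟨d, r, hdr, hr⟩ := hM.exists_star_mul_mul_eq_neg
  refine hr (eq_zero_of_opMulVec_eq_zero fun x => ?_)
  have h1 := h (d.opMulVec x)
  have hneg : ∀ i, (-(star r * r)).opMulVec x i = -((star r * r).opMulVec x i) := fun i => by
    simp [opMulVec]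
  rw [← sum_inner_opMulVec_star, ← opMulVec_mul, ← opMulVec_mul, hdr] at h1
  simp only [hneg, inner_neg_right, Finset.sum_neg_distrib] at h1
  rw [sum_inner_opMulVec_star_mul_self, Complex.neg_re, Complex.ofReal_re] at h1
  have h2 := (Finset.sum_eq_zero_iff_of_nonneg fun i _ => sq_nonneg ‖r.opMulVec x i‖).mp
    (le_antisymm (neg_nonneg.mp h1) (Finset.sum_nonneg fun i _ => sq_nonneg _))
  ext i
  simpa using h2 i (Finset.mem_univ i)

end CStarMatrix

/-! ### Operators on the Hilbert space tensor product -/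

section Tensor

variable {H E : Type*} [NormedAddCommGroup H] [InnerProductSpace ℂ H]
  [NormedAddCommGroup E] [InnerProductSpace ℂ E]

theorem HilbertTensor.clm_ext {G : Type*} [NormedAddCommGroup G] [NormedSpace ℂ G]
    {f g : HilbertTensor H E →L[ℂ] G}
    (h : ∀ x y, f (hilbertTmul x y) = g (hilbertTmul x y)) : f = g := by
  ext z
  induction z using UniformSpace.Completion.induction_on with
  | hp => exact isClosed_eq f.continuous g.continuous
  | ih a =>
    induction a using TensorProduct.induction_on with
    | zero => rw [UniformSpace.Completion.coe_zero, map_zero, map_zero]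
    | tmul x y => exact h x y
    | add a b ha hb => rw [UniformSpace.Completion.coe_add, map_add, map_add, ha, hb]

theorem hilbertTmul_add_left (x x' : H) (y : E) :
    hilbertTmul (x + x') y = hilbertTmul x y + hilbertTmul x' y := by
  rw [hilbertTmul, TensorProduct.add_tmul, UniformSpace.Completion.coe_add]
  rfl

theorem hilbertTmul_smul_left (c : ℂ) (x : H) (y : E) :
    hilbertTmul (c • x) y = c • hilbertTmul x y := by
  rw [hilbertTmul, ← TensorProduct.smul_tmul', UniformSpace.Completion.coe_smul, hilbertTmul]

theorem tensorOp_mul (A B : H →L[ℂ] H) (F G : E →L[ℂ] E) :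
    tensorOp A F * tensorOp B G = tensorOp (A * B) (F * G) :=
  HilbertTensor.clm_ext fun x y => by simp [tensorOp_hilbertTmul]

theorem tensorOp_one_one : tensorOp (1 : H →L[ℂ] H) (1 : E →L[ℂ] E) = 1 :=
  HilbertTensor.clm_ext fun x y => by simp [tensorOp_hilbertTmul]

theorem tensorOp_add_left (A B : H →L[ℂ] H) (F : E →L[ℂ] E) :
    tensorOp (A + B) F = tensorOp A F + tensorOp B F :=
  HilbertTensor.clm_ext fun x y => by simp [tensorOp_hilbertTmul, hilbertTmul_add_left]

theorem tensorOp_smul_left (c : ℂ) (A : H →L[ℂ] H) (F : E →L[ℂ] E) :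
    tensorOp (c • A) F = c • tensorOp A F :=
  HilbertTensor.clm_ext fun x y => by simp [tensorOp_hilbertTmul, hilbertTmul_smul_left]

theorem tensorOp_sub_right (A : H →L[ℂ] H) (F G : E →L[ℂ] E) :
    tensorOp A (F - G) = tensorOp A F - tensorOp A G :=
  HilbertTensor.clm_ext fun x y => by
    rw [sub_apply, tensorOp_hilbertTmul, tensorOp_hilbertTmul, tensorOp_hilbertTmul, sub_apply]
    simp only [hilbertTmul, TensorProduct.tmul_sub, UniformSpace.Completion.coe_sub]

/-- The embedding `y ↦ x ⊗ y` of `E` into the Hilbert space tensor product. -/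
noncomputable def hilbertTmulL (x : H) : E →L[ℂ] HilbertTensor H E :=
  UniformSpace.Completion.toComplL ∘L TensorProduct.mkL ℂ H E x

theorem hilbertTmulL_apply (x : H) (y : E) : hilbertTmulL x y = hilbertTmul x y := rfl

theorem norm_hilbertTmulL_le (x : H) : ‖(hilbertTmulL x : E →L[ℂ] HilbertTensor H E)‖ ≤ ‖x‖ :=
  opNorm_le_bound _ (norm_nonneg x) fun y => by
    rw [hilbertTmulL_apply, hilbertTmul, UniformSpace.Completion.norm_coe,
      TensorProduct.norm_tmul]

variable [CompleteSpace E]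

theorem adjoint_hilbertTmulL_hilbertTmul (e x : H) (y : E) :
    adjoint (hilbertTmulL e) (hilbertTmul x y) = ⟪e, x⟫_ℂ • y := by
  refine ext_inner_left ℂ fun z => ?_
  rw [adjoint_inner_right, hilbertTmulL_apply, inner_hilbertTmul, inner_smul_right]

theorem tensorOp_rankOne (x e : H) :
    tensorOp (InnerProductSpace.rankOne ℂ x e) (1 : E →L[ℂ] E) =
      hilbertTmulL x ∘L adjoint (hilbertTmulL e) :=
  HilbertTensor.clm_ext fun x' y => by
    simp [tensorOp_hilbertTmul, adjoint_hilbertTmulL_hilbertTmul, hilbertTmulL_apply,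
      hilbertTmul_smul_left]

/-- The commutant of `B(H) ⊗ 1` is `1 ⊗ B(E)`: with a unit vector `e`, the compression
`F = ⟨e| G |e⟩` works, since rank one operators move `e ⊗ y` to `x ⊗ y`. -/
theorem exists_eq_tensorOp_one_of_commute {G : HilbertTensor H E →L[ℂ] HilbertTensor H E}
    (hG : G.IsPositive) (hG1 : ‖G‖ ≤ 1)
    (hcomm : ∀ A : H →L[ℂ] H, G ∘L tensorOp A 1 = tensorOp A 1 ∘L G) :
    ∃ F : E →L[ℂ] E, F.IsPositive ∧ ‖F‖ ≤ 1 ∧ G = tensorOp 1 F := by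
  -- If `H = 0`, no unit vector exists, but `H ⊗ E = 0` and any `F` will do.
  rcases subsingleton_or_nontrivial H with hH | hH
  · refine ⟨0, isPositive_zero, by simp, HilbertTensor.clm_ext fun x y => ?_⟩
    have : hilbertTmul x y = 0 := by
      rw [Subsingleton.elim x ((0 : ℂ) • x), hilbertTmul_smul_left, zero_smul]
    rw [this, map_zero, map_zero]
  obtain ⟨e, he⟩ := exists_norm_eq H zero_le_one
  refine ⟨adjoint (hilbertTmulL e) ∘L G ∘L hilbertTmulL e, hG.adjoint_conj _, ?_, ?_⟩
  · have h1 : ‖(hilbertTmulL e : E →L[ℂ] HilbertTensor H E)‖ ≤ 1 :=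
      (norm_hilbertTmulL_le e).trans he.le
    calc _ ≤ ‖adjoint (hilbertTmulL e : E →L[ℂ] HilbertTensor H E)‖ *
          (‖G‖ * ‖(hilbertTmulL e : E →L[ℂ] HilbertTensor H E)‖) :=
          (opNorm_comp_le _ _).trans (by gcongr; exact opNorm_comp_le _ _)
      _ ≤ 1 * (1 * 1) := by
          rw [LinearIsometryEquiv.norm_map]
          gcongr
      _ = 1 := by norm_num
  · refine HilbertTensor.clm_ext fun x y => ?_
    -- A rank one operator moves `e ⊗ y` to `x ⊗ y`, and its amplification commutes with `G`.
    have hx : hilbertTmul x y =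
        tensorOp (InnerProductSpace.rankOne ℂ x e) (1 : E →L[ℂ] E) (hilbertTmul e y) := by
      simp [tensorOp_hilbertTmul, he]
    conv_lhs => rw [hx, ← comp_apply, hcomm, tensorOp_rankOne]
    simp [tensorOp_hilbertTmul, hilbertTmulL_apply]

variable [CompleteSpace H]

theorem adjoint_tensorOp (A : H →L[ℂ] H) (F : E →L[ℂ] E) :
    adjoint (tensorOp A F) = tensorOp (adjoint A) (adjoint F) := by
  refine HilbertTensor.clm_ext fun x y => ?_
  rw [← innerSL_inj (𝕜 := ℂ)]
  refine HilbertTensor.clm_ext fun x' y' => ?_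
  simp [tensorOp_hilbertTmul, inner_hilbertTmul, adjoint_inner_left]

variable (H E) in
/-- The amplification `A ↦ A ⊗ 1` as a homomorphism of star algebras. -/
noncomputable def amplification :
    (H →L[ℂ] H) →⋆ₐ[ℂ] (HilbertTensor H E →L[ℂ] HilbertTensor H E) where
  toFun A := tensorOp A 1
  map_one' := tensorOp_one_one
  map_mul' A B := by rw [tensorOp_mul, one_mul]
  map_zero' := by simpa using tensorOp_smul_left (E := E) 0 (0 : H →L[ℂ] H) 1
  map_add' A B := tensorOp_add_left A B 1
  commutes' c := by
    rw [Algebra.algebraMap_eq_smul_one, tensorOp_smul_left, tensorOp_one_one,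
      Algebra.algebraMap_eq_smul_one]
  map_star' A := by
    rw [star_eq_adjoint, star_eq_adjoint, adjoint_tensorOp, ← star_eq_adjoint (1 : E →L[ℂ] E),
      star_one]

theorem amplification_apply (A : H →L[ℂ] H) : amplification H E A = tensorOp A 1 := rfl

theorem amplification_mul_apply (A B : H →L[ℂ] H) (z : HilbertTensor H E) :
    amplification H E (A * B) z = amplification H E A (amplification H E B z) := by
  rw [map_mul]
  rfl

end Tensor

/-! ### Forms attached to positive definite kernels -/

section Kernel

/-- A positive semidefinite sesquilinear form dominated by `‖L x‖²` is of the form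
`⟪L x, G (L y)⟫` with `0 ≤ G ≤ 1`: `L x ↦ x` extends to a contraction `J` from `K` to
the completion of `X` for the form, and `G = J⋆ J`. -/
theorem exists_isPositive_inner_eq {X K : Type*} [AddCommGroup X] [Module ℂ X]
    [NormedAddCommGroup K] [InnerProductSpace ℂ K] [CompleteSpace K]
    (c : PreInnerProductSpace.Core ℂ X) (L : X →ₗ[ℂ] K) (hL : DenseRange L)
    (h : ∀ x, (c.inner x x).re ≤ ‖L x‖ ^ 2) :
    ∃ G : K →L[ℂ] K, G.IsPositive ∧ ‖G‖ ≤ 1 ∧ ∀ x y, ⟪L x, G (L y)⟫_ℂ = c.inner x y := by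
  let : SeminormedAddCommGroup X := InnerProductSpace.Core.toSeminormedAddCommGroup (c := c)
  let : InnerProductSpace ℂ X := InnerProductSpace.ofCore c
  let j : X →ₗ[ℂ] UniformSpace.Completion X :=
    (UniformSpace.Completion.toComplL (𝕜 := ℂ) (E := X)).toLinearMap
  have hj : ∀ x, ‖j x‖ ≤ 1 * ‖L x‖ := fun x => by
    have h1 : ‖j x‖ = ‖x‖ := UniformSpace.Completion.norm_coe x
    rw [one_mul, h1]
    refine le_of_sq_le_sq ?_ (norm_nonneg _)
    rw [← inner_self_eq_norm_sq (𝕜 := ℂ)]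
    exact h x
  let J : K →L[ℂ] UniformSpace.Completion X := j.extendOfNorm L
  have hJ : ∀ x, J (L x) = j x := LinearMap.extendOfNorm_eq hL ⟨1, hj⟩
  have hJ1 : ‖J‖ ≤ 1 := opNorm_le_bound _ zero_le_one
    (LinearMap.norm_extendOfNorm_apply_le hL 1 hj)
  refine ⟨adjoint J ∘L J, isPositive_adjoint_comp_self J, ?_, fun x y => ?_⟩
  · rw [norm_adjoint_comp_self]
    exact mul_le_one₀ hJ1 (norm_nonneg _) hJ1
  · rw [comp_apply, adjoint_inner_right, hJ, hJ]
    exact UniformSpace.Completion.inner_coe x y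

variable {ι H : Type*} [NormedAddCommGroup H] [InnerProductSpace ℂ H] [CompleteSpace H]

/-- The positive semidefinite form `∑ᵢⱼ ⟪xᵢ, k i j yⱼ⟫` on finitely supported functions attached to
an operator-valued positive definite kernel `k`. -/
@[reducible] noncomputable def kernelCore (k : ι → ι → H →L[ℂ] H)
    (hk : ∀ i j, adjoint (k i j) = k j i)
    (hpos : ∀ (s : Finset ι) (x : ι → H), 0 ≤ (∑ i ∈ s, ∑ j ∈ s, ⟪x i, k i j (x j)⟫_ℂ).re) :
    PreInnerProductSpace.Core ℂ (ι →₀ H) where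
  inner x y := x.sum fun i v => y.sum fun j w => ⟪v, k i j w⟫_ℂ
  conj_inner_symm x y := by
    simp only [Finsupp.sum, map_sum, inner_conj_symm]
    rw [Finset.sum_comm]
    simp only [← adjoint_inner_right, hk]
  re_inner_nonneg x := hpos x.support x
  add_left x y z := by
    classical
    exact Finsupp.sum_add_index' (by simp) fun i v w => by
      simp [Finsupp.sum_add]
  smul_left x y r := by
    rw [Finsupp.sum_smul_index' (by simp)]
    simp only [Finsupp.sum, Finset.mul_sum, inner_smul_left]

theorem kernelCore_inner_single (k : ι → ι → H →L[ℂ] H) (hk : ∀ i j, adjoint (k i j) = k j i)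
    (hpos : ∀ (s : Finset ι) (x : ι → H), 0 ≤ (∑ i ∈ s, ∑ j ∈ s, ⟪x i, k i j (x j)⟫_ℂ).re)
    (i j : ι) (v w : H) :
    (kernelCore k hk hpos).inner (Finsupp.single i v) (Finsupp.single j w) = ⟪v, k i j w⟫_ℂ := by
  change (Finsupp.single i v).sum (fun i v => (Finsupp.single j w).sum fun j w => ⟪v, k i j w⟫_ℂ)
    = _
  rw [Finsupp.sum_single_index (by simp), Finsupp.sum_single_index (by simp)]

end Kernel

/-! ### Complete positivity and quadratic forms -/

section CompletelyPositive

variable {H₁ H₂ K : Type*}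
  [NormedAddCommGroup H₁] [InnerProductSpace ℂ H₁] [CompleteSpace H₁]
  [NormedAddCommGroup H₂] [InnerProductSpace ℂ H₂] [CompleteSpace H₂]
  [NormedAddCommGroup K] [InnerProductSpace ℂ K] [CompleteSpace K]

/-- Matrices `(aᵢ⋆ aⱼ)` are nonnegative, being `N⋆ N` for the matrix `N` with a single nonzero row
`(aⱼ)`. -/
theorem CStarMatrix.nonneg_of_star_mul {n A : Type*} [Fintype n] [NonUnitalCStarAlgebra A]
    [PartialOrder A] [StarOrderedRing A] (a : n → A) :
    0 ≤ (CStarMatrix.ofMatrix (Matrix.of fun i j => star (a i) * a j) : CStarMatrix n n A) := by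
  classical
  -- The row index `k` is arbitrary, so the empty matrix is treated apart.
  rcases isEmpty_or_nonempty n with hn | ⟨⟨k⟩⟩
  · exact (CStarMatrix.ext fun i => hn.elim i : (0 : CStarMatrix n n A) = _).le
  · refine CStarAlgebra.nonneg_iff_exists_eq_star_mul_self.mpr
      ⟨CStarMatrix.ofMatrix (Matrix.of fun i j => if i = k then a j else 0), ?_⟩
    ext i j
    simp only [CStarMatrix.mul_apply, CStarMatrix.star_apply, CStarMatrix.ofMatrix_apply,
      Matrix.of_apply]
    rw [Finset.sum_eq_single k (fun b _ hb => by simp [hb]) (by simp)]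
    simp

theorem CompletelyPositiveMap.re_sum_inner_nonneg (S : (H₁ →L[ℂ] H₁) →CP (H₂ →L[ℂ] H₂))
    (s : Finset (H₁ →L[ℂ] H₁)) (x : (H₁ →L[ℂ] H₁) → H₂) :
    0 ≤ (∑ A ∈ s, ∑ B ∈ s, ⟪x A, S (star A * B) (x B)⟫_ℂ).re := by
  have h := CStarMatrix.re_sum_inner_nonneg (S.map_cstarMatrix_nonneg _
    (CStarMatrix.nonneg_of_star_mul fun A : s => (A : H₁ →L[ℂ] H₁))) (fun A => x A)
  simp only [CStarMatrix.opMulVec, CStarMatrix.map_apply, CStarMatrix.ofMatrix_apply,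
    Matrix.of_apply, inner_sum] at h
  rw [← Finset.sum_coe_sort s]
  simpa only [← Finset.sum_coe_sort s] using h

theorem CompletelyPositiveMap.adjoint_map (S : (H₁ →L[ℂ] H₁) →CP (H₂ →L[ℂ] H₂))
    (A : H₁ →L[ℂ] H₁) : adjoint (S A) = S (adjoint A) :=
  (map_star S A).symm

/-- Maps in Stinespring form `A ↦ W⋆ π(A) W` are completely positive. -/
theorem map_adjoint_comp_nonneg (π : (H₁ →L[ℂ] H₁) →⋆ₐ[ℂ] (K →L[ℂ] K)) (W : H₂ →L[ℂ] K)
    {n : Type*} [Fintype n] {M : CStarMatrix n n (H₁ →L[ℂ] H₁)} (hM : 0 ≤ M) :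
    0 ≤ M.map fun A => adjoint W ∘L π A ∘L W := by
  have hs : ∀ i j, adjoint (M j i) = M i j := fun i j => by
    rw [← star_eq_adjoint, ← CStarMatrix.star_apply, (IsSelfAdjoint.of_nonneg hM).star_eq]
  refine CStarMatrix.nonneg_of_re_sum_inner_nonneg ?_ fun x => ?_
  · ext1 i j
    rw [CStarMatrix.star_apply, CStarMatrix.map_apply, CStarMatrix.map_apply, ← hs i j,
      ← star_eq_adjoint (M j i), map_star]
    simp only [star_eq_adjoint, adjoint_comp, adjoint_adjoint, comp_assoc]
  · have hπ : 0 ≤ M.map π :=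
      (CompletelyPositiveMapClass.toCompletelyPositiveLinearMap π).map_cstarMatrix_nonneg M hM
    simpa only [CStarMatrix.opMulVec, CStarMatrix.map_apply, comp_apply, inner_sum,
      adjoint_inner_right] using CStarMatrix.re_sum_inner_nonneg hπ fun i => W (x i)

end CompletelyPositive

/-! ### Domination and the commutant -/

section RadonNikodym

variable {H₁ H₂ E : Type*}
  [NormedAddCommGroup H₁] [InnerProductSpace ℂ H₁] [CompleteSpace H₁]
  [NormedAddCommGroup H₂] [InnerProductSpace ℂ H₂] [CompleteSpace H₂]
  [NormedAddCommGroup E] [InnerProductSpace ℂ E] [CompleteSpace E]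

theorem adjoint_tensorOp_comp_tensorOp (A : H₁ →L[ℂ] H₁) (K : E →L[ℂ] E) :
    adjoint (tensorOp 1 K) ∘L tensorOp A (1 : E →L[ℂ] E) ∘L tensorOp 1 K =
      tensorOp A (star K * K) := by
  rw [← mul_def, ← mul_def, adjoint_tensorOp, tensorOp_mul, tensorOp_mul, ← star_eq_adjoint,
    ← star_eq_adjoint, star_one, one_mul, mul_one, one_mul]

/-- With `1 - F = K⋆ K`, the difference `T - S` has the Stinespring form given by `(1 ⊗ K) V`. -/
theorem completelyDominated_of_eq {S T : (H₁ →L[ℂ] H₁) →CP (H₂ →L[ℂ] H₂)}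
    {V : H₂ →L[ℂ] HilbertTensor H₁ E}
    (hT : ∀ A, T A = adjoint V ∘L tensorOp A (1 : E →L[ℂ] E) ∘L V)
    {F : E →L[ℂ] E} (hF : F.IsPositive) (hF1 : ‖F‖ ≤ 1)
    (hS : ∀ A, S A = adjoint V ∘L tensorOp A F ∘L V) : CompletelyDominated S T := by
  have h1F : 0 ≤ 1 - F := sub_nonneg.mpr <|
    (CStarAlgebra.norm_le_one_iff_of_nonneg F ((nonneg_iff_isPositive F).mpr hF)).mp hF1
  obtain ⟨K, hK⟩ := CStarAlgebra.nonneg_iff_exists_eq_star_mul_self.mp h1F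
  have key : ∀ A, T A - S A =
      adjoint (tensorOp 1 K ∘L V) ∘L amplification H₁ E A ∘L (tensorOp 1 K ∘L V) := fun A => by
    have h := adjoint_tensorOp_comp_tensorOp A K
    rw [← hK, tensorOp_sub_right] at h
    ext φ
    have hφ := DFunLike.congr_fun h (V φ)
    rw [hT, hS, amplification_apply, adjoint_comp]
    simp only [sub_apply, comp_apply] at hφ ⊢
    rw [hφ, map_sub]
  have hfun : ⇑(T.toLinearMap - S.toLinearMap) = fun A =>
      adjoint (tensorOp 1 K ∘L V) ∘L amplification H₁ E A ∘L (tensorOp 1 K ∘L V) :=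
    funext key
  refine ⟨⟨T.toLinearMap - S.toLinearMap, fun k M hM => ?_⟩, rfl⟩
  rw [hfun]
  exact map_adjoint_comp_nonneg _ _ hM

/-- The operator `G` is the Radon–Nikodym derivative of `S` with respect to `T`, obtained on the
dense span of the vectors `(A ⊗ 1) V ψ` from the form `⟪ψ, S(A⋆ B) φ⟫`. -/
theorem exists_isPositive_inner_amplification {S T : (H₁ →L[ℂ] H₁) →CP (H₂ →L[ℂ] H₂)}
    {V : H₂ →L[ℂ] HilbertTensor H₁ E} (hV : IsCanonicalStinespring T V)
    (hST : CompletelyDominated S T) :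
    ∃ G : HilbertTensor H₁ E →L[ℂ] HilbertTensor H₁ E, G.IsPositive ∧ ‖G‖ ≤ 1 ∧
      ∀ A B ψ φ, ⟪amplification H₁ E A (V ψ), G (amplification H₁ E B (V φ))⟫_ℂ =
        ⟪ψ, S (star A * B) φ⟫_ℂ := by
  obtain ⟨R, hR⟩ := hST
  -- Complete positivity of `R = T - S` gives the upper bound on the form.
  have hR' : ∀ A, T A = R A + S A := fun A => by
    have := LinearMap.congr_fun hR A
    exact (eq_sub_iff_add_eq.mp this).symm
  have hT : ∀ A B ψ φ, ⟪amplification H₁ E A (V ψ), amplification H₁ E B (V φ)⟫_ℂ =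
      ⟪ψ, T (star A * B) φ⟫_ℂ := fun A B ψ φ => by
    rw [hV.dilation, ← amplification_apply, comp_apply, comp_apply, adjoint_inner_right, map_mul,
      map_star, star_eq_adjoint, mul_def, comp_apply, adjoint_inner_right]
  let L : ((H₁ →L[ℂ] H₁) →₀ H₂) →ₗ[ℂ] HilbertTensor H₁ E :=
    Finsupp.lsum ℂ fun A => (amplification H₁ E A ∘L V).toLinearMap
  have hLsum : ∀ x, L x = ∑ A ∈ x.support, amplification H₁ E A (V (x A)) := fun x => rfl
  have hLs : ∀ A ψ, L (Finsupp.single A ψ) = amplification H₁ E A (V ψ) := fun A ψ =>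
    Finsupp.lsum_single ..
  let c := kernelCore (fun A B => S (star A * B))
    (fun A B => by rw [S.adjoint_map, ← star_eq_adjoint, star_mul, star_star])
    S.re_sum_inner_nonneg
  have hdense : DenseRange L := by
    have hle : Submodule.span ℂ {x | ∃ (A : H₁ →L[ℂ] H₁) (ψ : H₂), x = tensorOp A 1 (V ψ)} ≤
        LinearMap.range L := Submodule.span_le.mpr fun x ⟨A, ψ, hx⟩ =>
      ⟨Finsupp.single A ψ, (hLs A ψ).trans hx.symm⟩
    exact (Submodule.dense_iff_topologicalClosure_eq_top.mpr hV.minimal).mono hle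
  have hbound : ∀ x, (c.inner x x).re ≤ ‖L x‖ ^ 2 := fun x => by
    have hnorm : ‖L x‖ ^ 2 =
        (∑ A ∈ x.support, ∑ B ∈ x.support, ⟪x A, T (star A * B) (x B)⟫_ℂ).re := by
      rw [← inner_self_eq_norm_sq (𝕜 := ℂ), hLsum]
      simp only [sum_inner, inner_sum, hT]
      rw [Finset.sum_comm]
      rfl
    have hRS : (∑ A ∈ x.support, ∑ B ∈ x.support, ⟪x A, T (star A * B) (x B)⟫_ℂ).re =
        (∑ A ∈ x.support, ∑ B ∈ x.support, ⟪x A, R (star A * B) (x B)⟫_ℂ).re +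
          (c.inner x x).re := by
      simp only [hR', add_apply, inner_add_right, Finset.sum_add_distrib, Complex.add_re]
      rfl
    rw [hnorm, hRS]
    exact le_add_of_nonneg_left (R.re_sum_inner_nonneg _ _)
  obtain ⟨G, hG, hG1, hGL⟩ := exists_isPositive_inner_eq c L hdense hbound
  refine ⟨G, hG, hG1, fun A B ψ φ => ?_⟩
  rw [← hLs, ← hLs, hGL]
  exact kernelCore_inner_single ..

/-- The Radon–Nikodym derivative commutes with the amplification, because
`⟪(A ⊗ 1)Vψ, G (C ⊗ 1)(B ⊗ 1)Vφ⟫ = ⟪ψ, S(A⋆ C B)φ⟫ = ⟪(C⋆ ⊗ 1)(A ⊗ 1)Vψ, G (B ⊗ 1)Vφ⟫`. -/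
theorem IsCanonicalStinespring.commute_amplification {S T : (H₁ →L[ℂ] H₁) →CP (H₂ →L[ℂ] H₂)}
    {V : H₂ →L[ℂ] HilbertTensor H₁ E} (hV : IsCanonicalStinespring T V)
    {G : HilbertTensor H₁ E →L[ℂ] HilbertTensor H₁ E}
    (hG : ∀ A B ψ φ, ⟪amplification H₁ E A (V ψ), G (amplification H₁ E B (V φ))⟫_ℂ =
        ⟪ψ, S (star A * B) φ⟫_ℂ) (C : H₁ →L[ℂ] H₁) :
    G ∘L tensorOp C 1 = tensorOp C 1 ∘L G := by
  have hdense := Submodule.dense_iff_topologicalClosure_eq_top.mpr hV.minimal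
  refine ext_on hdense ?_
  rintro _ ⟨B, φ, rfl⟩
  rw [← innerSL_inj (𝕜 := ℂ)]
  refine ext_on hdense ?_
  rintro _ ⟨A, ψ, rfl⟩
  simp only [innerSL_apply_apply]
  rw [← inner_conj_symm, ← inner_conj_symm (tensorOp C 1 ∘L G <| _)]
  congr 1
  simp only [← amplification_apply, comp_apply]
  rw [← adjoint_inner_left (amplification H₁ E C), ← star_eq_adjoint, ← map_star]
  rw [← amplification_mul_apply, ← amplification_mul_apply, hG, hG, star_mul, star_star, mul_assoc]

end RadonNikodym

theorem mainTheorem2 {H₁ H₂ E : Type*}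
    [NormedAddCommGroup H₁] [InnerProductSpace ℂ H₁] [CompleteSpace H₁]
    [NormedAddCommGroup H₂] [InnerProductSpace ℂ H₂] [CompleteSpace H₂]
    [NormedAddCommGroup E] [InnerProductSpace ℂ E] [CompleteSpace E]
    (S T : (H₁ →L[ℂ] H₁) →CP (H₂ →L[ℂ] H₂))
    (V : H₂ →L[ℂ] HilbertTensor H₁ E) (hV : IsCanonicalStinespring T V) :
    CompletelyDominated S T ↔
      ∃ F : E →L[ℂ] E, F.IsPositive ∧ ‖F‖ ≤ 1 ∧
        ∀ A : H₁ →L[ℂ] H₁,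
          S A = ContinuousLinearMap.adjoint V ∘L tensorOp A F ∘L V := by
  refine ⟨fun hST => ?_, fun ⟨F, hF, hF1, hS⟩ => completelyDominated_of_eq hV.dilation hF hF1 hS⟩
  obtain ⟨G, hG, hG1, hGS⟩ := exists_isPositive_inner_amplification hV hST
  obtain ⟨F, hF, hF1, rfl⟩ :=
    exists_eq_tensorOp_one_of_commute hG hG1 (hV.commute_amplification hGS)
  refine ⟨F, hF, hF1, fun A => ?_⟩
  ext φ
  refine ext_inner_left ℂ fun ψ => ?_
  -- The value of the form of `G = 1 ⊗ F` at `(1 ⊗ 1) V ψ` and `(A ⊗ 1) V φ`.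
  have h := hGS 1 A ψ φ
  rw [map_one, star_one, one_mul, one_apply_eq_self, amplification_apply, ← comp_apply,
    ← mul_def, tensorOp_mul, one_mul, mul_one] at h
  rw [← h, comp_apply, comp_apply, adjoint_inner_right]
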